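/- Let $(\tilde L^{2m+1},\Phi,\xi,\eta,g)$ be an almost contact metric manifold, i.e. a Riemannian manifold with a smooth $(1,1)$-tensor field $\Phi$, vector field $\xi$ and $1$-form $\eta$ such that $$\Phi^2=-I+\eta\otimes\xi,\quad \eta(\xi)=1,\quad \Phi\xi=0,\quad \eta\circ\Phi=0,\quad g(\Phi X,\Phi Y)=g(X,Y)-\eta(X)\eta(Y),$$ and suppose that it is locally conformal almost cosymplectic with smooth function $\beta:\tilde L\to\mathbb R$, i.e. that the Levi-Civita connection $\tilde\nabla$ of $g$ satisfies $$(\tilde\nabla_X\Phi)Y=\beta\big(g(\Phi X,Y)\xi-\eta(Y)\Phi X\big),\qquad \tilde\nabla_X\xi=\beta\big(X-\eta(X)\xi\big)$$ for all vector fields $X,Y$ on $\tilde L$. Let $L_\nu,L_T,L_\perp$ be Riemannian manifolds with metrics $g_\nu,g_T,g_\perp$, with $\dim L_T>0$ and $\dim L_\perp>0$, let $\varphi_1,\varphi_2:L_\nu\to(0,\infty)$ be smooth non-constant functions, and let $L=L_\nu\times_{\varphi_1}L_T\times_{\varphi_2}L_\perp$ be the bi-warped product, i.e. $L_\nu\times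 L_T\times L_\perp$ with the metric $\pi_\nu^*g_\nu+(\varphi_1\circ\pi_\nu)^2\,\pi_T^*g_T+(\varphi_2\circ\pi_\nu)^2\,\pi_\perp^*g_\perp$, where $\pi_\nu,\pi_T,\pi_\perp$ are the projections. Let $f:L\to\tilde L$ be a smooth isometric immersion such that - each leaf $f(L_\nu\times\{q\}\times\{r\})$ is a proper slant submanifold of $\tilde L$ with the same slant angle $\nu\in[0,\pi/2]$: for every tangent vector $X$ of the leaf that is linearly independent of $\xi$, the angle between $\Phi X$ and the tangent space of the leaf is $\nu$, and the leaf is neither invariant nor anti-invariant; - each leaf $f(\{p\}\times L_T\times\{r\})$ is invariant ($\Phi$ maps each of its tangent spaces into itself); - each leaf $f(\{p\}\times\{q\}\times L_\perp)$ is anti-invariant ($\Phi$ maps each of its tangent spaces into the orthogonal complement of that space); - $\xi$ is tangent to $L_\nu$, i.e. along $f$ it is tangent to the leaves $f(L_\nu\times\{q\}\times\{r\})$. Then, along $L$, $$\xi(\ln\varphi_i)=\beta,\qquad i=1,2.$$ That is, for all $(p,q,r)\in L$, if $u\in T_pL_\nu$ is the vector with $df_{(p,q,r)}(u,0,0)=\xi_{f(p,q,r)}$,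 then $d(\ln\varphi_i)_p(u)=\beta(f(p,q,r))$ for $i=1,2$. -/

import Mathlib

open Bundle
open scoped Manifold ContDiff

noncomputable section

/-! ### Almost contact metric manifolds and the locally conformal almost cosymplectic condition -/

/-- A smooth almost contact metric structure `(Φ, ξ, η, g)` on the `d`-dimensional Riemannian
manifold `M`; the metric `g` is the inner product carried by the tangent bundle. -/
structure AlmostContactMetricStructure (d : ℕ) (M : Type*) [TopologicalSpace M]
    [ChartedSpace (EuclideanSpace ℝ (Fin d)) M] [IsManifold (𝓡 d) ∞ M]
    [RiemannianBundle (fun x : M ↦ TangentSpace (𝓡 d) x)] where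
  /-- the `(1,1)`-tensor field -/
  Φ : ∀ x : M, TangentSpace (𝓡 d) x →L[ℝ] TangentSpace (𝓡 d) x
  /-- the structure (Reeb) vector field -/
  ξ : ∀ x : M, TangentSpace (𝓡 d) x
  /-- the dual `1`-form -/
  η : ∀ x : M, TangentSpace (𝓡 d) x →L[ℝ] ℝ
  contMDiff_Φ : ContMDiff (𝓡 d)
    ((𝓡 d).prod 𝓘(ℝ, EuclideanSpace ℝ (Fin d) →L[ℝ] EuclideanSpace ℝ (Fin d))) ∞
    (fun x ↦ TotalSpace.mk' (EuclideanSpace ℝ (Fin d) →L[ℝ] EuclideanSpace ℝ (Fin d))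
      (E := fun x : M ↦ TangentSpace (𝓡 d) x →L[ℝ] TangentSpace (𝓡 d) x) x (Φ x))
  contMDiff_ξ : ContMDiff (𝓡 d) ((𝓡 d).prod 𝓘(ℝ, EuclideanSpace ℝ (Fin d))) ∞
    (fun x ↦ TotalSpace.mk' (EuclideanSpace ℝ (Fin d))
      (E := fun x : M ↦ TangentSpace (𝓡 d) x) x (ξ x))
  contMDiff_η : ContMDiff (𝓡 d) ((𝓡 d).prod 𝓘(ℝ, EuclideanSpace ℝ (Fin d) →L[ℝ] ℝ)) ∞
    (fun x ↦ TotalSpace.mk' (EuclideanSpace ℝ (Fin d) →L[ℝ] ℝ)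
      (E := fun x : M ↦ TangentSpace (𝓡 d) x →L[ℝ] Bundle.Trivial M ℝ x) x (η x))
  Φ_Φ : ∀ (x : M) (X : TangentSpace (𝓡 d) x), Φ x (Φ x X) = -X + η x X • ξ x
  η_ξ : ∀ x : M, η x (ξ x) = 1
  Φ_ξ : ∀ x : M, Φ x (ξ x) = 0
  η_Φ : ∀ (x : M) (X : TangentSpace (𝓡 d) x), η x (Φ x X) = 0
  inner_Φ_Φ : ∀ (x : M) (X Y : TangentSpace (𝓡 d) x),
    inner ℝ (Φ x X) (Φ x Y) = inner ℝ X Y - η x X * η x Y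

/-- `cov` is the Levi-Civita connection of the Riemannian manifold `M`: torsion free and metric. -/
def IsLeviCivita {d : ℕ} {M : Type*} [TopologicalSpace M]
    [ChartedSpace (EuclideanSpace ℝ (Fin d)) M] [IsManifold (𝓡 d) ∞ M]
    [RiemannianBundle (fun x : M ↦ TangentSpace (𝓡 d) x)]
    [IsContMDiffRiemannianBundle (𝓡 d) ∞ (EuclideanSpace ℝ (Fin d))
      (fun x : M ↦ TangentSpace (𝓡 d) x)]
    (cov : CovariantDerivative (𝓡 d) (EuclideanSpace ℝ (Fin d))
      (fun x : M ↦ TangentSpace (𝓡 d) x)) : Prop :=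
  haveI : IsContMDiffRiemannianBundle (𝓡 d) 1 (EuclideanSpace ℝ (Fin d))
      (fun x : M ↦ TangentSpace (𝓡 d) x) :=
    IsContMDiffRiemannianBundle.of_le (n := ∞) (by exact_mod_cast le_top)
  cov.torsion = 0 ∧ cov.IsMetricCompatible

/-- The almost contact metric manifold `(M, Φ, ξ, η, g)` is locally conformal almost cosymplectic
with function `β`: with `∇` the Levi-Civita connection of `g`,
`(∇_X Φ) Y = β (g(Φ X, Y) ξ - η(Y) Φ X)` and `∇_X ξ = β (X - η(X) ξ)`,
where `(∇_X Φ) Y = ∇_X (Φ Y) - Φ (∇_X Y)`. In Mathlib `cov Y x X` is `∇_X Y` at `x`. -/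
def IsLocallyConformalAlmostCosymplectic {d : ℕ} {M : Type*} [TopologicalSpace M]
    [ChartedSpace (EuclideanSpace ℝ (Fin d)) M] [IsManifold (𝓡 d) ∞ M]
    [RiemannianBundle (fun x : M ↦ TangentSpace (𝓡 d) x)]
    [IsContMDiffRiemannianBundle (𝓡 d) ∞ (EuclideanSpace ℝ (Fin d))
      (fun x : M ↦ TangentSpace (𝓡 d) x)]
    (S : AlmostContactMetricStructure d M) (β : M → ℝ) : Prop :=
  ContMDiff (𝓡 d) 𝓘(ℝ, ℝ) ∞ β ∧
  ∃ cov : CovariantDerivative (𝓡 d) (EuclideanSpace ℝ (Fin d))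
      (fun x : M ↦ TangentSpace (𝓡 d) x),
    IsLeviCivita cov ∧
    (∀ Y : (∀ x : M, TangentSpace (𝓡 d) x),
      ContMDiff (𝓡 d) ((𝓡 d).prod 𝓘(ℝ, EuclideanSpace ℝ (Fin d))) ∞
        (fun x ↦ TotalSpace.mk' (EuclideanSpace ℝ (Fin d))
          (E := fun x : M ↦ TangentSpace (𝓡 d) x) x (Y x)) →
      ∀ (x : M) (X : TangentSpace (𝓡 d) x),
        cov (fun y ↦ S.Φ y (Y y)) x X - S.Φ x (cov Y x X) =
          β x • ((inner ℝ (S.Φ x X) (Y x) : ℝ) • S.ξ x - S.η x (Y x) • S.Φ x X)) ∧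
    (∀ (x : M) (X : TangentSpace (𝓡 d) x),
      cov S.ξ x X = β x • (X - S.η x X • S.ξ x))

/-! ### Immersed submanifolds `ι : N → M` of an almost contact metric manifold -/

/-- The tangent space of the immersed submanifold `ι : N → M` at `y`, inside `T_{ι y} M`. -/
def immersedTangentSpace {k d : ℕ} {N M : Type*} [TopologicalSpace N]
    [ChartedSpace (EuclideanSpace ℝ (Fin k)) N] [TopologicalSpace M]
    [ChartedSpace (EuclideanSpace ℝ (Fin d)) M] (ι : N → M) (y : N) :
    Submodule ℝ (TangentSpace (𝓡 d) (ι y)) :=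
  LinearMap.range (mfderiv (𝓡 k) (𝓡 d) ι y).toLinearMap

section Submanifolds

variable {k d : ℕ} {N M : Type*} [TopologicalSpace N]
  [ChartedSpace (EuclideanSpace ℝ (Fin k)) N] [TopologicalSpace M]
  [ChartedSpace (EuclideanSpace ℝ (Fin d)) M] [IsManifold (𝓡 d) ∞ M]
  [RiemannianBundle (fun x : M ↦ TangentSpace (𝓡 d) x)]

/-- The angle in `[0, π/2]` between a tangent vector `v` and a subspace `W` of a tangent space,
i.e. the angle between `v` and its orthogonal projection to `W`. -/
def angleWithSubspace {x : M} (v : TangentSpace (𝓡 d) x)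
    (W : Submodule ℝ (TangentSpace (𝓡 d) x)) : ℝ :=
  haveI : FiniteDimensional ℝ (TangentSpace (𝓡 d) x) :=
    inferInstanceAs (FiniteDimensional ℝ (EuclideanSpace ℝ (Fin d)))
  InnerProductGeometry.angle v (W.starProjection v)

/-- The vector field `ξ` is tangent to the submanifold `ι : N → M`. -/
def IsReebTangent (S : AlmostContactMetricStructure d M) (ι : N → M) : Prop :=
  ∀ y : N, S.ξ (ι y) ∈ immersedTangentSpace (k := k) ι y

/-- Invariant submanifold: `Φ (T_y N) ⊆ T_y N`. -/
def IsInvariantSubmanifold (S : AlmostContactMetricStructure d M) (ι : N → M) : Prop :=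
  ∀ y : N, ∀ X ∈ immersedTangentSpace (k := k) ι y,
    S.Φ (ι y) X ∈ immersedTangentSpace (k := k) ι y

/-- Anti-invariant submanifold: `Φ (T_y N)` is orthogonal to `T_y N`. -/
def IsAntiInvariantSubmanifold (S : AlmostContactMetricStructure d M) (ι : N → M) : Prop :=
  ∀ y : N, ∀ X ∈ immersedTangentSpace (k := k) ι y, ∀ Z ∈ immersedTangentSpace (k := k) ι y,
    inner ℝ (S.Φ (ι y) X) Z = (0 : ℝ)

/-- Slant submanifold with slant angle `ν ∈ [0, π/2]`: for every tangent vector `X` linearly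
independent of `ξ`, the angle between `Φ X` and the tangent space is `ν`. -/
def IsSlantSubmanifold (S : AlmostContactMetricStructure d M) (ι : N → M) (ν : ℝ) : Prop :=
  ν ∈ Set.Icc 0 (Real.pi / 2) ∧
  ∀ y : N, ∀ X ∈ immersedTangentSpace (k := k) ι y,
    LinearIndependent ℝ ![X, S.ξ (ι y)] →
      angleWithSubspace (S.Φ (ι y) X) (immersedTangentSpace (k := k) ι y) = ν

/-- Proper slant submanifold: slant, but neither invariant nor anti-invariant. -/
def IsProperSlantSubmanifold (S : AlmostContactMetricStructure d M) (ι : N → M) (ν : ℝ) : Prop :=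
  IsSlantSubmanifold (k := k) S ι ν ∧ ¬ IsInvariantSubmanifold (k := k) S ι ∧
    ¬ IsAntiInvariantSubmanifold (k := k) S ι

end Submanifolds

/-! ### Bi-warped products -/

/-- `f : L₁ × L₂ × L₃ → M` is a smooth isometric immersion of the bi-warped product
`L₁ ×_{φ₁} L₂ ×_{φ₂} L₃`: `φ₁, φ₂ : L₁ → ℝ` are smooth, positive and non-constant, and the metric
induced by `f` is `π₁^* g₁ + (φ₁ ∘ π₁)² π₂^* g₂ + (φ₂ ∘ π₁)² π₃^* g₃`. -/
structure IsBiWarpedProductImmersion {k₁ k₂ k₃ d : ℕ} {L₁ L₂ L₃ M : Type*}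
    [TopologicalSpace L₁] [ChartedSpace (EuclideanSpace ℝ (Fin k₁)) L₁]
    [TopologicalSpace L₂] [ChartedSpace (EuclideanSpace ℝ (Fin k₂)) L₂]
    [TopologicalSpace L₃] [ChartedSpace (EuclideanSpace ℝ (Fin k₃)) L₃]
    [TopologicalSpace M] [ChartedSpace (EuclideanSpace ℝ (Fin d)) M]
    [RiemannianBundle (fun p : L₁ ↦ TangentSpace (𝓡 k₁) p)]
    [RiemannianBundle (fun q : L₂ ↦ TangentSpace (𝓡 k₂) q)]
    [RiemannianBundle (fun r : L₃ ↦ TangentSpace (𝓡 k₃) r)]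
    [RiemannianBundle (fun x : M ↦ TangentSpace (𝓡 d) x)]
    (f : L₁ × L₂ × L₃ → M) (φ₁ φ₂ : L₁ → ℝ) : Prop where
  contMDiff : ContMDiff ((𝓡 k₁).prod ((𝓡 k₂).prod (𝓡 k₃))) (𝓡 d) ∞ f
  contMDiff_φ₁ : ContMDiff (𝓡 k₁) 𝓘(ℝ, ℝ) ∞ φ₁
  contMDiff_φ₂ : ContMDiff (𝓡 k₁) 𝓘(ℝ, ℝ) ∞ φ₂
  φ₁_pos : ∀ p, 0 < φ₁ p
  φ₂_pos : ∀ p, 0 < φ₂ p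
  φ₁_nonconst : ¬ ∃ c : ℝ, ∀ p, φ₁ p = c
  φ₂_nonconst : ¬ ∃ c : ℝ, ∀ p, φ₂ p = c
  inner_mfderiv : ∀ (x : L₁ × L₂ × L₃)
    (v w : TangentSpace ((𝓡 k₁).prod ((𝓡 k₂).prod (𝓡 k₃))) x),
    (inner ℝ (mfderiv ((𝓡 k₁).prod ((𝓡 k₂).prod (𝓡 k₃))) (𝓡 d) f x v)
        (mfderiv ((𝓡 k₁).prod ((𝓡 k₂).prod (𝓡 k₃))) (𝓡 d) f x w) : ℝ) =
      inner ℝ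
        (mfderiv ((𝓡 k₁).prod ((𝓡 k₂).prod (𝓡 k₃))) (𝓡 k₁) (fun y : L₁ × L₂ × L₃ ↦ y.1) x v)
        (mfderiv ((𝓡 k₁).prod ((𝓡 k₂).prod (𝓡 k₃))) (𝓡 k₁) (fun y : L₁ × L₂ × L₃ ↦ y.1) x w)
      + φ₁ x.1 ^ 2 * inner ℝ
        (mfderiv ((𝓡 k₁).prod ((𝓡 k₂).prod (𝓡 k₃))) (𝓡 k₂) (fun y : L₁ × L₂ × L₃ ↦ y.2.1) x v)
        (mfderiv ((𝓡 k₁).prod ((𝓡 k₂).prod (𝓡 k₃))) (𝓡 k₂) (fun y : L₁ × L₂ × L₃ ↦ y.2.1) x w)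
      + φ₂ x.1 ^ 2 * inner ℝ
        (mfderiv ((𝓡 k₁).prod ((𝓡 k₂).prod (𝓡 k₃))) (𝓡 k₃) (fun y : L₁ × L₂ × L₃ ↦ y.2.2) x v)
        (mfderiv ((𝓡 k₁).prod ((𝓡 k₂).prod (𝓡 k₃))) (𝓡 k₃) (fun y : L₁ × L₂ × L₃ ↦ y.2.2) x w)

end

/-! The identity comes from computing `g(∇_v ξ, v)` in two ways for a vector `v` tangent to `L_T ×
L_⊥`. Since `ξ` is tangent to the `L_ν`-leaves, `v` is orthogonal to `ξ`, so `η(v) = g(ξ, v) = 0`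
and the structure equation gives `g(∇_v ξ, v) = β |v|²`.

For the second computation, take a curve `P` in `L_ν` whose initial velocity is the vector `u`
representing `ξ`, take curves `Q`, `R` in the other factors, and put `F(s, t) = f(P s, Q t, R t)`.
At `t = 0` the warped metric gives `|∂F/∂t|² = φ₁(P s)² |Q'|² + φ₂(P s)² |R'|²`, whose
`s`-derivative at `0` contains `u(φᵢ)`. By first variation this derivative is also `2 g(∇_v ξ, v)`.
With `R` constant only the `φ₁` terms survive, with `Q` constant only the `φ₂` terms; dividing by
`φᵢ²` and the squared speed gives `u(ln φᵢ) = β`.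

The delicate point is that `∂F/∂s = ξ` is known only at the origin: the `L_ν`-component of `ξ` might
a priori vary with `(q, r)`. However, `ξ - ∂F/∂s` is tangent to the `L_ν`-leaves along `s = 0`,
hence orthogonal to `∂F/∂t`, and it vanishes at the origin. Differentiating this orthogonality in
`t` gives exactly what first variation needs (`IsLeviCivita.hasDerivAt_inner_variation`). That
computation is done in one chart, so no covariant derivative along maps is required;
`IsLeviCivita.two_mul_inner_eq` translates `g(∇_v V, v)` into chart derivatives. -/

open VectorField Topology

/-! ### Vector fields and Lie brackets in a fixed chart -/

section ChartCoordinates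

variable {d : ℕ} {M : Type*} [TopologicalSpace M]
  [ChartedSpace (EuclideanSpace ℝ (Fin d)) M] [IsManifold (𝓡 d) ∞ M]

/-- Coordinates of tangent vectors in the preferred chart at `x₀`. -/
noncomputable def tangentCoord (x₀ x : M) : TangentSpace (𝓡 d) x →L[ℝ] EuclideanSpace ℝ (Fin d) :=
  (trivializationAt (EuclideanSpace ℝ (Fin d)) (TangentSpace (𝓡 d)) x₀).continuousLinearMapAt ℝ x

/-- The vector field with constant coordinates `v` in the preferred chart at `x₀`. -/
noncomputable def coordVectorField (x₀ : M) (v : EuclideanSpace ℝ (Fin d)) (x : M) : TangentSpace (𝓡 d) x :=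
  (trivializationAt (EuclideanSpace ℝ (Fin d)) (TangentSpace (𝓡 d)) x₀).symmL ℝ x v

theorem tangentCoord_apply {x₀ x : M} (hx : x ∈ (chartAt (EuclideanSpace ℝ (Fin d)) x₀).source)
    (v : TangentSpace (𝓡 d) x) :
    tangentCoord x₀ x v = (trivializationAt (EuclideanSpace ℝ (Fin d)) (TangentSpace (𝓡 d)) x₀
      (TotalSpace.mk' (EuclideanSpace ℝ (Fin d)) x v)).2 := by
  have hx' : x ∈ (trivializationAt (EuclideanSpace ℝ (Fin d))
    (TangentSpace (𝓡 d)) x₀).baseSet := by simpa using hx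
  exact congr_fun (Trivialization.coe_linearMapAt_of_mem (R := ℝ) _ hx') v

theorem tangentCoord_eq_mfderiv {x₀ x : M}
    (hx : x ∈ (chartAt (EuclideanSpace ℝ (Fin d)) x₀).source) :
    tangentCoord x₀ x = mfderiv (𝓡 d) 𝓘(ℝ, EuclideanSpace ℝ (Fin d)) (extChartAt (𝓡 d) x₀) x := by
  exact TangentBundle.continuousLinearMapAt_trivializationAt hx

theorem tangentCoord_self (x₀ : M) (v : TangentSpace (𝓡 d) x₀) : tangentCoord x₀ x₀ v = v := by
  rw [tangentCoord_eq_mfderiv (by simp), mfderiv_extChartAt_self]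
  rfl

theorem tangentCoord_coordVectorField {x₀ x : M}
    (hx : x ∈ (chartAt (EuclideanSpace ℝ (Fin d)) x₀).source) (v : EuclideanSpace ℝ (Fin d)) :
    tangentCoord x₀ x (coordVectorField x₀ v x) = v :=
  (trivializationAt (EuclideanSpace ℝ (Fin d))
    (TangentSpace (𝓡 d)) x₀).continuousLinearMapAt_symmL (by simpa using hx) v

theorem coordVectorField_tangentCoord {x₀ x : M}
    (hx : x ∈ (chartAt (EuclideanSpace ℝ (Fin d)) x₀).source) (v : TangentSpace (𝓡 d) x) :
    coordVectorField x₀ (tangentCoord x₀ x v) x = v :=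
  (trivializationAt (EuclideanSpace ℝ (Fin d))
    (TangentSpace (𝓡 d)) x₀).symmL_continuousLinearMapAt (by simpa using hx) v

theorem coordVectorField_self (x₀ : M) (v : TangentSpace (𝓡 d) x₀) :
    coordVectorField x₀ v x₀ = v := by
  conv_lhs => rw [← tangentCoord_self x₀ v]
  exact coordVectorField_tangentCoord (by simp) v

theorem mdifferentiableAt_tangentCoord {x₀ : M} {V : ∀ x : M, TangentSpace (𝓡 d) x}
    (hV : MDifferentiableAt (𝓡 d) ((𝓡 d).prod 𝓘(ℝ, EuclideanSpace ℝ (Fin d)))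
      (fun x ↦ TotalSpace.mk' (EuclideanSpace ℝ (Fin d))
        (E := fun x : M ↦ TangentSpace (𝓡 d) x) x (V x)) x₀) :
    MDifferentiableAt (𝓡 d) 𝓘(ℝ, EuclideanSpace ℝ (Fin d))
      (fun x ↦ tangentCoord x₀ x (V x)) x₀ := by
  refine ((mdifferentiableAt_section (IB := 𝓡 d) V).1 hV).congr_of_eventuallyEq ?_
  filter_upwards [(chartAt (EuclideanSpace ℝ (Fin d)) x₀).open_source.mem_nhds
    (mem_chart_source _ x₀)] with x hx
  exact tangentCoord_apply hx (V x)

theorem mdifferentiableAt_coordVectorField (x₀ : M) (v : EuclideanSpace ℝ (Fin d)) :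
    MDifferentiableAt (𝓡 d) ((𝓡 d).prod 𝓘(ℝ, EuclideanSpace ℝ (Fin d)))
      (fun x ↦ TotalSpace.mk' (EuclideanSpace ℝ (Fin d))
        (E := fun x : M ↦ TangentSpace (𝓡 d) x) x (coordVectorField x₀ v x)) x₀ := by
  refine (mdifferentiableAt_section (IB := 𝓡 d) (coordVectorField x₀ v)).2
    ((mdifferentiableAt_const (c := v)).congr_of_eventuallyEq ?_)
  filter_upwards [(chartAt (EuclideanSpace ℝ (Fin d)) x₀).open_source.mem_nhds
    (mem_chart_source _ x₀)] with x hx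
  exact (tangentCoord_apply hx _).symm.trans (tangentCoord_coordVectorField hx v)

/-- In the chart the second field is constant, so only the derivative of `V` survives in the
bracket. With torsion zero, this expresses `∇_v V` through `∇_V` of a coordinate field. -/
theorem mlieBracket_coordVectorField (x₀ : M) {V : ∀ x : M, TangentSpace (𝓡 d) x}
    (hV : MDifferentiableAt (𝓡 d) ((𝓡 d).prod 𝓘(ℝ, EuclideanSpace ℝ (Fin d)))
      (fun x ↦ TotalSpace.mk' (EuclideanSpace ℝ (Fin d))
        (E := fun x : M ↦ TangentSpace (𝓡 d) x) x (V x)) x₀)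
    (v : EuclideanSpace ℝ (Fin d)) :
    mlieBracket (𝓡 d) V (coordVectorField x₀ v) x₀ =
      -coordVectorField x₀ (mvfderiv (𝓡 d) (fun x ↦ tangentCoord x₀ x (V x)) x₀
        (coordVectorField x₀ v x₀)) x₀ := by
  have hself : ∀ w : EuclideanSpace ℝ (Fin d), coordVectorField x₀ w x₀ = w :=
    fun w ↦ coordVectorField_self x₀ w
  -- Pulling a field back by the inverse chart amounts to reading its chart coordinates, because the
  -- derivatives of the chart and of its inverse are mutually inverse.
  have key : ∀ W : ∀ x : M, TangentSpace (𝓡 d) x,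
      mpullbackWithin 𝓘(ℝ, EuclideanSpace ℝ (Fin d)) (𝓡 d) (extChartAt (𝓡 d) x₀).symm W
        (Set.range (𝓡 d)) =ᶠ[𝓝 (extChartAt (𝓡 d) x₀ x₀)]
      (fun y ↦ tangentCoord x₀ ((extChartAt (𝓡 d) x₀).symm y)
        (W ((extChartAt (𝓡 d) x₀).symm y))) := by
    intro W
    filter_upwards [extChartAt_target_mem_nhds (I := 𝓡 d) x₀] with y hy
    have hy' := (extChartAt (𝓡 d) x₀).map_target hy
    rw [extChartAt_source] at hy'
    rw [tangentCoord_eq_mfderiv hy']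
    exact (isInvertible_mfderivWithin_extChartAt_symm hy).inverse_apply_eq.2
      congr($(mfderivWithin_extChartAt_symm_comp_mfderiv_extChartAt hy) _).symm
  have hc : mpullbackWithin 𝓘(ℝ, EuclideanSpace ℝ (Fin d)) (𝓡 d) (extChartAt (𝓡 d) x₀).symm
      (coordVectorField x₀ v) (Set.range (𝓡 d)) =ᶠ[𝓝 (extChartAt (𝓡 d) x₀ x₀)] fun _ ↦ v := by
    refine (key _).trans ?_
    filter_upwards [extChartAt_target_mem_nhds (I := 𝓡 d) x₀] with y hy
    have hy' := (extChartAt (𝓡 d) x₀).map_target hy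
    rw [extChartAt_source] at hy'
    exact tangentCoord_coordVectorField hy' v
  have hd : MDifferentiableAt (𝓡 d) 𝓘(ℝ, EuclideanSpace ℝ (Fin d))
    (fun x ↦ tangentCoord x₀ x (V x)) x₀ := mdifferentiableAt_tangentCoord hV
  have hb := ((key V).lieBracketWithin_vectorField_eq_nhds hc (𝕜 := ℝ) (s := Set.range (𝓡 d)))
  -- The bracket is transported back to `M` by the inverse derivative of the chart, which is the
  -- identity at the base point.
  refine ((isInvertible_mfderiv_extChartAt (I := 𝓡 d)
    (mem_extChartAt_source x₀)).inverse_apply_eq.2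
    (congr($(mfderiv_extChartAt_self (I := 𝓡 d) (x := x₀)) _).symm)).trans ?_
  rw [Set.preimage_univ, Set.univ_inter]
  refine hb.trans ?_
  have e : lieBracketWithin ℝ (fun y ↦ tangentCoord x₀ ((extChartAt (𝓡 d) x₀).symm y)
      (V ((extChartAt (𝓡 d) x₀).symm y))) (fun _ ↦ v) (Set.range (𝓡 d)) (extChartAt (𝓡 d) x₀ x₀) =
      -(mvfderiv (𝓡 d) (fun x ↦ tangentCoord x₀ x (V x)) x₀ v) := by
    rw [lieBracketWithin, fderivWithin_fun_const, mvfderiv, hd.mfderiv]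
    simp only [Pi.zero_apply, zero_apply, zero_sub]
    rfl
  exact e.trans (congrArg Neg.neg ((hself _).trans (congrArg _ (hself v)))).symm

end ChartCoordinates

/-! ### The metric and the Levi-Civita connection in a chart -/

section MetricInChart

variable {d : ℕ} {M : Type*} [TopologicalSpace M]
  [ChartedSpace (EuclideanSpace ℝ (Fin d)) M] [IsManifold (𝓡 d) ∞ M]
  [RiemannianBundle (fun x : M ↦ TangentSpace (𝓡 d) x)]

/-- `G` is the metric of `M` read in the preferred chart at `x₀`. -/
structure IsMetricInChart (x₀ : M)
    (G : M → EuclideanSpace ℝ (Fin d) →L[ℝ] EuclideanSpace ℝ (Fin d) →L[ℝ] ℝ) : Prop where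
  mdifferentiableAt : MDifferentiableAt (𝓡 d)
    𝓘(ℝ, EuclideanSpace ℝ (Fin d) →L[ℝ] EuclideanSpace ℝ (Fin d) →L[ℝ] ℝ) G x₀
  inner_eq : ∀ x ∈ (chartAt (EuclideanSpace ℝ (Fin d)) x₀).source,
    ∀ v w : TangentSpace (𝓡 d) x,
      (inner ℝ v w : ℝ) = G x (tangentCoord x₀ x v) (tangentCoord x₀ x w)

theorem exists_isMetricInChart
    [IsContMDiffRiemannianBundle (𝓡 d) ∞ (EuclideanSpace ℝ (Fin d))
      (fun x : M ↦ TangentSpace (𝓡 d) x)]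
    (x₀ : M) :
    ∃ G : M → EuclideanSpace ℝ (Fin d) →L[ℝ] EuclideanSpace ℝ (Fin d) →L[ℝ] ℝ,
      IsMetricInChart x₀ G := by
  obtain ⟨g, hg, hgi⟩ := IsContMDiffRiemannianBundle.exists_contMDiff (IB := 𝓡 d) (n := ∞)
    (F := EuclideanSpace ℝ (Fin d)) (E := fun x : M ↦ TangentSpace (𝓡 d) x)
  have h1 := ((contMDiffAt_hom_bundle _).1 (hg x₀)).2.mdifferentiableAt (by simp)
  refine ⟨_, h1, fun x hx v w ↦ ?_⟩
  have hx' : x ∈ (trivializationAt (EuclideanSpace ℝ (Fin d))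
    (TangentSpace (𝓡 d)) x₀).baseSet := by simpa using hx
  refine (hgi x v w).trans (Eq.symm ?_)
  refine (inCoordinates_apply_eq₂ hx' hx' (Set.mem_univ _)).trans ?_
  have hv := coordVectorField_tangentCoord hx v
  have hw := coordVectorField_tangentCoord hx w
  rw [coordVectorField, Trivialization.symmL_apply _ hx'] at hv hw
  rw [Trivialization.coe_linearMapAt_of_mem (R := ℝ) (trivializationAt ℝ (fun _ : M ↦ ℝ) x₀)
    (Set.mem_univ _)]
  refine Eq.trans ?_ congr(g x $hv $hw)
  rfl

theorem IsMetricInChart.symm {x₀ : M}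
    {G : M → EuclideanSpace ℝ (Fin d) →L[ℝ] EuclideanSpace ℝ (Fin d) →L[ℝ] ℝ}
    (hG : IsMetricInChart x₀ G) {x : M}
    (hx : x ∈ (chartAt (EuclideanSpace ℝ (Fin d)) x₀).source) (v w : EuclideanSpace ℝ (Fin d)) :
    G x v w = G x w v := by
  have h1 := hG.inner_eq x hx (coordVectorField x₀ v x) (coordVectorField x₀ w x)
  have h2 := hG.inner_eq x hx (coordVectorField x₀ w x) (coordVectorField x₀ v x)
  rw [tangentCoord_coordVectorField hx, tangentCoord_coordVectorField hx] at h1 h2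
  rw [← h1, ← h2, real_inner_comm]

set_option synthInstance.maxHeartbeats 200000 in
/-- The derivative of the metric along `V` in the chart, i.e. the formula for the Lie derivative
`(L_V g)(v, v) = 2 g(∇_v V, v)`. -/
theorem IsLeviCivita.two_mul_inner_eq
    [IsContMDiffRiemannianBundle (𝓡 d) ∞ (EuclideanSpace ℝ (Fin d))
      (fun x : M ↦ TangentSpace (𝓡 d) x)]
    {cov : CovariantDerivative (𝓡 d) (EuclideanSpace ℝ (Fin d))
      (fun x : M ↦ TangentSpace (𝓡 d) x)}
    (hcov : IsLeviCivita cov) {x₀ : M}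
    {G : M → EuclideanSpace ℝ (Fin d) →L[ℝ] EuclideanSpace ℝ (Fin d) →L[ℝ] ℝ}
    (hG : IsMetricInChart x₀ G) {V : ∀ x : M, TangentSpace (𝓡 d) x}
    (hV : MDifferentiableAt (𝓡 d) ((𝓡 d).prod 𝓘(ℝ, EuclideanSpace ℝ (Fin d)))
      (fun x ↦ TotalSpace.mk' (EuclideanSpace ℝ (Fin d))
        (E := fun x : M ↦ TangentSpace (𝓡 d) x) x (V x)) x₀) (v : EuclideanSpace ℝ (Fin d)) :
    2 * (inner ℝ (cov V x₀ (coordVectorField x₀ v x₀)) (coordVectorField x₀ v x₀) : ℝ) =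
      mvfderiv (𝓡 d) G x₀ (V x₀) v v
        + 2 * G x₀ (mvfderiv (𝓡 d) (fun x ↦ tangentCoord x₀ x (V x)) x₀
          (coordVectorField x₀ v x₀)) v := by
  have i3 : IsContMDiffRiemannianBundle (𝓡 d) 1 (EuclideanSpace ℝ (Fin d))
      (fun x : M ↦ TangentSpace (𝓡 d) x) :=
    IsContMDiffRiemannianBundle.of_le (n := ∞) (by exact_mod_cast le_top)
  obtain ⟨ht, hm⟩ := hcov
  have hv := mdifferentiableAt_coordVectorField (d := d) x₀ v
  -- With `C` the coordinate field of `v`, zero torsion gives `∇_V C - ∇_C V = [V, C]`; below,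
  -- metric compatibility gives `V g(C, C) = 2 g(∇_V C, C)`.
  have e1 := (CovariantDerivative.torsion_eq_zero_iff cov).1 ht hV hv
  rw [mlieBracket_coordVectorField x₀ hV v] at e1
  have e2 := hm.mvfderiv_inner_eq V hv hv
  have e3 : cov V x₀ (coordVectorField x₀ v x₀) = cov (coordVectorField x₀ v) x₀ (V x₀)
      + coordVectorField x₀ (mvfderiv (𝓡 d) (fun x ↦ tangentCoord x₀ x (V x)) x₀
        (coordVectorField x₀ v x₀)) x₀ := by
    rw [sub_eq_iff_eq_add] at e1
    rw [e1]
    abel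
  have e4 : mvfderiv (𝓡 d) (fun x ↦ (inner ℝ (coordVectorField x₀ v x)
      (coordVectorField x₀ v x) : ℝ)) x₀ (V x₀) = mvfderiv (𝓡 d) G x₀ (V x₀) v v := by
    have : (fun x ↦ (inner ℝ (coordVectorField x₀ v x) (coordVectorField x₀ v x) : ℝ))
        =ᶠ[𝓝 x₀] fun x ↦ G x v v := by
      filter_upwards [(chartAt (EuclideanSpace ℝ (Fin d)) x₀).open_source.mem_nhds
        (mem_chart_source _ x₀)] with x hx
      rw [hG.inner_eq x hx, tangentCoord_coordVectorField hx]
    have hd : HasMFDerivAt (𝓡 d) 𝓘(ℝ, ℝ) (fun x ↦ G x v v) x₀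
        (((ContinuousLinearMap.apply ℝ ℝ v).comp
          (ContinuousLinearMap.apply ℝ (EuclideanSpace ℝ (Fin d) →L[ℝ] ℝ) v)).comp
            (mvfderiv (𝓡 d) G x₀)) :=
      HasMFDerivAt.comp x₀ (((ContinuousLinearMap.apply ℝ ℝ v).comp
          (ContinuousLinearMap.apply ℝ (EuclideanSpace ℝ (Fin d) →L[ℝ] ℝ) v)).hasMFDerivAt
            (x := G x₀)) hG.mdifferentiableAt.hasMFDerivAt
    have := (hd.congr_of_eventuallyEq this).mfderiv
    exact congr($this (V x₀))
  simp only [e4] at e2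
  rw [real_inner_comm (cov (coordVectorField x₀ v) x₀ (V x₀))] at e2
  rw [e2, e3, inner_add_left, hG.inner_eq x₀ (mem_chart_source _ x₀)
      (coordVectorField x₀ (mvfderiv (𝓡 d) _ x₀ _) x₀),
    tangentCoord_coordVectorField (mem_chart_source _ x₀),
    tangentCoord_coordVectorField (mem_chart_source _ x₀)]
  ring

end MetricInChart

/-! ### First variation of the squared speed -/

section Variations

variable {d : ℕ} {M : Type*} [TopologicalSpace M]
  [ChartedSpace (EuclideanSpace ℝ (Fin d)) M]

theorem hasDerivAt_bilinear_apply {E : Type*} [NormedAddCommGroup E] [NormedSpace ℝ E]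
    {g : ℝ → E →L[ℝ] E →L[ℝ] ℝ} {a b : ℝ → E} {g' : E →L[ℝ] E →L[ℝ] ℝ} {a' b' : E} {t : ℝ}
    (hg : HasDerivAt g g' t) (ha : HasDerivAt a a' t) (hb : HasDerivAt b b' t) :
    HasDerivAt (fun s ↦ g s (a s) (b s))
      (g' (a t) (b t) + g t a' (b t) + g t (a t) b') t := by
  simpa using (hg.clm_apply ha).clm_apply hb

theorem hasDerivAt_comp_mfderiv {X : Type*} [NormedAddCommGroup X] [NormedSpace ℝ X] {H : M → X}
    {F : ℝ × ℝ → M} {γ : ℝ → ℝ × ℝ} {γ' : ℝ × ℝ} {t : ℝ}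
    (hH : MDifferentiableAt (𝓡 d) 𝓘(ℝ, X) H (F (γ t)))
    (hF : MDifferentiableAt 𝓘(ℝ, ℝ × ℝ) (𝓡 d) F (γ t)) (hγ : HasDerivAt γ γ' t) :
    HasDerivAt (fun s ↦ H (F (γ s)))
      (mvfderiv (𝓡 d) H (F (γ t)) (mfderiv 𝓘(ℝ, ℝ × ℝ) (𝓡 d) F (γ t) γ')) t := by
  have h := hasMFDerivAt_iff_hasFDerivAt.1
    (HasMFDerivAt.comp (γ t) hH.hasMFDerivAt hF.hasMFDerivAt)
  exact h.comp_hasDerivAt t hγ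

variable [IsManifold (𝓡 d) ∞ M] [RiemannianBundle (fun x : M ↦ TangentSpace (𝓡 d) x)]
  [IsContMDiffRiemannianBundle (𝓡 d) ∞ (EuclideanSpace ℝ (Fin d))
    (fun x : M ↦ TangentSpace (𝓡 d) x)]

set_option synthInstance.maxHeartbeats 200000 in
/-- First variation formula: if the variation `F (s, t)` has velocity `V` in the direction `s` at
the origin, and if `V` and `∂F/∂s` are both orthogonal to `∂F/∂t` along `s = 0`, then
`∂/∂s |∂F/∂t|² = 2 g(∇_v V, v)` at the origin, where `v = ∂F/∂t`. -/
theorem IsLeviCivita.hasDerivAt_inner_variation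
    {cov : CovariantDerivative (𝓡 d) (EuclideanSpace ℝ (Fin d))
      (fun x : M ↦ TangentSpace (𝓡 d) x)}
    (hcov : IsLeviCivita cov) {F : ℝ × ℝ → M}
    (hF : ContMDiffAt 𝓘(ℝ, ℝ × ℝ) (𝓡 d) 2 F (0, 0))
    {V : ∀ x : M, TangentSpace (𝓡 d) x}
    (hV : MDifferentiableAt (𝓡 d) ((𝓡 d).prod 𝓘(ℝ, EuclideanSpace ℝ (Fin d)))
      (fun x ↦ TotalSpace.mk' (EuclideanSpace ℝ (Fin d))
        (E := fun x : M ↦ TangentSpace (𝓡 d) x) x (V x)) (F (0, 0)))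
    (hFV : mfderiv 𝓘(ℝ, ℝ × ℝ) (𝓡 d) F (0, 0) ((1, 0) : ℝ × ℝ) = V (F (0, 0)))
    (hF_orth : ∀ᶠ t : ℝ in 𝓝 0,
      inner ℝ (mfderiv 𝓘(ℝ, ℝ × ℝ) (𝓡 d) F (0, t) ((1, 0) : ℝ × ℝ))
        (mfderiv 𝓘(ℝ, ℝ × ℝ) (𝓡 d) F (0, t) ((0, 1) : ℝ × ℝ)) = (0 : ℝ))
    (hV_orth : ∀ᶠ t : ℝ in 𝓝 0,
      inner ℝ (V (F (0, t))) (mfderiv 𝓘(ℝ, ℝ × ℝ) (𝓡 d) F (0, t) ((0, 1) : ℝ × ℝ)) = (0 : ℝ)) :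
    HasDerivAt (fun s : ℝ ↦ (inner ℝ (mfderiv 𝓘(ℝ, ℝ × ℝ) (𝓡 d) F (s, 0) ((0, 1) : ℝ × ℝ))
        (mfderiv 𝓘(ℝ, ℝ × ℝ) (𝓡 d) F (s, 0) ((0, 1) : ℝ × ℝ)) : ℝ))
      (2 * inner ℝ
        (cov V (F (0, 0)) (mfderiv 𝓘(ℝ, ℝ × ℝ) (𝓡 d) F (0, 0) ((0, 1) : ℝ × ℝ)))
        (mfderiv 𝓘(ℝ, ℝ × ℝ) (𝓡 d) F (0, 0) ((0, 1) : ℝ × ℝ))) 0 := by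
  obtain ⟨G, hG⟩ := exists_isMetricInChart (d := d) (F (0, 0))
  have hx₀ := mem_chart_source (EuclideanSpace ℝ (Fin d)) (F (0, 0))
  have hsrc : ∀ᶠ z in 𝓝 ((0, 0) : ℝ × ℝ),
      F z ∈ (chartAt (EuclideanSpace ℝ (Fin d)) (F (0, 0))).source :=
    hF.continuousAt.eventually_mem ((chartAt _ (F (0, 0))).open_source.mem_nhds hx₀)
  have hFd : ∀ᶠ z in 𝓝 ((0, 0) : ℝ × ℝ), MDifferentiableAt 𝓘(ℝ, ℝ × ℝ) (𝓡 d) F z :=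
    ((contMDiffAt_iff_contMDiffAt_nhds (by simp)).1 hF).mono fun z hz ↦ hz.mdifferentiableAt (by simp)
  have hF0 := hFd.self_of_nhds
  set c : ℝ × ℝ → EuclideanSpace ℝ (Fin d) := fun z ↦ extChartAt (𝓡 d) (F (0, 0)) (F z)
  have hc2 : ContDiffAt ℝ 2 c (0, 0) :=
    contMDiffAt_iff_contDiffAt.1 ((contMDiffAt_extChartAt (I := 𝓡 d)).comp (0, 0) hF)
  have hcoord : ∀ᶠ z in 𝓝 ((0, 0) : ℝ × ℝ), ∀ w : ℝ × ℝ,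
      tangentCoord (F (0, 0)) (F z) (mfderiv 𝓘(ℝ, ℝ × ℝ) (𝓡 d) F z w) = fderiv ℝ c z w := by
    filter_upwards [hsrc, hFd] with z hz hzd w
    rw [tangentCoord_eq_mfderiv hz]
    rw [← mfderiv_eq_fderiv]
    exact congr($(mfderiv_comp z (mdifferentiableAt_extChartAt (I := 𝓡 d) hz) hzd) w).symm
  have hcd : DifferentiableAt ℝ (fderiv ℝ c) (0, 0) :=
    (hc2.fderiv_right (m := 1) (by norm_num)).differentiableAt (by simp)
  -- Equality of mixed partials stands in for the symmetry lemma `D_s ∂_t F = D_t ∂_s F`; this is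
  -- where second-order smoothness of `F` matters.
  have hsymm : fderiv ℝ (fderiv ℝ c) (0, 0) (1, 0) (0, 1)
      = fderiv ℝ (fderiv ℝ c) (0, 0) (0, 1) (1, 0) :=
    (hc2.isSymmSndFDerivAt (by simp)) _ _
  have hγ₁ : HasDerivAt (fun s : ℝ ↦ (s, (0 : ℝ))) (1, 0) 0 :=
    (hasDerivAt_id 0).prodMk (hasDerivAt_const _ _)
  have hγ₂ : HasDerivAt (fun t : ℝ ↦ ((0 : ℝ), t)) (0, 1) 0 :=
    (hasDerivAt_const _ _).prodMk (hasDerivAt_id 0)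
  have hcd' : ∀ {γ : ℝ → ℝ × ℝ} {γ' : ℝ × ℝ}, γ 0 = (0, 0) → HasDerivAt γ γ' 0 → ∀ w : ℝ × ℝ,
      HasDerivAt (fun t ↦ fderiv ℝ c (γ t) w) (fderiv ℝ (fderiv ℝ c) (0, 0) γ' w) 0 := by
    intro γ γ' h0 hγ w
    rw [← h0] at hcd ⊢
    simpa using (hcd.hasFDerivAt.comp_hasDerivAt 0 hγ).clm_apply (hasDerivAt_const 0 w)
  have t₁ : Filter.Tendsto (fun s : ℝ ↦ (s, (0 : ℝ))) (𝓝 0) (𝓝 (0, 0)) :=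
    hγ₁.continuousAt
  have t₂ : Filter.Tendsto (fun t : ℝ ↦ ((0 : ℝ), t)) (𝓝 0) (𝓝 (0, 0)) :=
    hγ₂.continuousAt
  set v := fderiv ℝ c (0, 0) (0, 1) with hv
  have hv' : mfderiv 𝓘(ℝ, ℝ × ℝ) (𝓡 d) F (0, 0) ((0, 1) : ℝ × ℝ)
      = coordVectorField (F (0, 0)) v (F (0, 0)) := by
    rw [hv, ← hcoord.self_of_nhds, coordVectorField_tangentCoord hx₀]
  -- the orthogonality relation, differentiated along `s = 0`
  have hA : G (F (0, 0))
      (mvfderiv (𝓡 d) (fun x ↦ tangentCoord (F (0, 0)) x (V x)) (F (0, 0))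
        (coordVectorField (F (0, 0)) v (F (0, 0)))
        - fderiv ℝ (fderiv ℝ c) (0, 0) (0, 1) (1, 0)) v = 0 := by
    have d1 := hasDerivAt_comp_mfderiv (d := d) (t := 0) hG.mdifferentiableAt hF0 hγ₂
    have d2 := (hasDerivAt_comp_mfderiv (d := d) (t := 0)
      (mdifferentiableAt_tangentCoord hV) hF0 hγ₂).sub (hcd' rfl hγ₂ (1, 0))
    have d3 := hasDerivAt_bilinear_apply d1 d2 (hcd' rfl hγ₂ (0, 1))
    have hz : (fun t : ℝ ↦ G (F (0, t)) (tangentCoord (F (0, 0)) (F (0, t)) (V (F (0, t)))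
        - fderiv ℝ c (0, t) (1, 0)) (fderiv ℝ c (0, t) (0, 1))) =ᶠ[𝓝 0] fun _ ↦ 0 := by
      filter_upwards [hF_orth, hV_orth, t₂.eventually hcoord, t₂.eventually hsrc]
        with t h1 h2 h3 h4
      rw [hG.inner_eq _ h4, h3, h3] at h1
      rw [hG.inner_eq _ h4, h3] at h2
      simp [h1, h2]
    have d4 := d3.unique ((hasDerivAt_const (0 : ℝ) (0 : ℝ)).congr_of_eventuallyEq hz)
    -- Since `V - ∂F/∂s` vanishes at the origin, the product-rule terms that differentiate `G` or
    -- `∂F/∂t` drop out.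
    have h0 : tangentCoord (F (0, 0)) (F (0, 0)) (V (F (0, 0))) - fderiv ℝ c (0, 0) (1, 0) = 0 := by
      rw [← hcoord.self_of_nhds, hFV, sub_self]
    simp only [Pi.sub_apply, h0, map_zero, zero_apply, zero_add, add_zero] at d4
    rw [hv'] at d4
    exact d4
  have hB := hcov.two_mul_inner_eq hG hV v
  rw [hv', hB]
  have d1 := hasDerivAt_comp_mfderiv (d := d) (γ := fun s ↦ (s, 0)) (t := 0)
    hG.mdifferentiableAt hF0 hγ₁
  have d3 := hasDerivAt_bilinear_apply d1 (hcd' (γ := fun s ↦ (s, 0)) rfl hγ₁ (0, 1))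
    (hcd' (γ := fun s ↦ (s, 0)) rfl hγ₁ (0, 1))
  have hz : (fun s : ℝ ↦ (inner ℝ (mfderiv 𝓘(ℝ, ℝ × ℝ) (𝓡 d) F (s, 0) ((0, 1) : ℝ × ℝ))
        (mfderiv 𝓘(ℝ, ℝ × ℝ) (𝓡 d) F (s, 0) ((0, 1) : ℝ × ℝ)) : ℝ)) =ᶠ[𝓝 0]
      fun s ↦ G (F (s, 0)) (fderiv ℝ c (s, 0) (0, 1)) (fderiv ℝ c (s, 0) (0, 1)) := by
    filter_upwards [t₁.eventually hcoord, t₁.eventually hsrc] with s h3 h4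
    rw [hG.inner_eq _ h4, h3]
  refine (d3.congr_of_eventuallyEq hz).congr_deriv ?_
  -- After swapping the mixed partials, `hA` replaces `∂_t ∂_s c` by the derivative of `V` along
  -- `v`; they need agree only when paired with `v`.
  rw [hFV, hG.symm hx₀ (fderiv ℝ c (0, 0) (0, 1)), hsymm]
  rw [map_sub, sub_apply, sub_eq_zero] at hA
  rw [hA]
  ring

end Variations

/-! ### Curves with prescribed velocity and derivatives along them -/

section Curves

variable {k : ℕ} {N : Type*} [TopologicalSpace N]
  [ChartedSpace (EuclideanSpace ℝ (Fin k)) N] 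

/-- Every tangent vector is the velocity of a curve. -/
theorem exists_curve_mfderiv_eq [IsManifold (𝓡 k) ∞ N] (p : N) (w : EuclideanSpace ℝ (Fin k)) :
    ∃ P : ℝ → N, P 0 = p ∧ ContMDiffAt 𝓘(ℝ, ℝ) (𝓡 k) 2 P 0 ∧
      (mfderiv 𝓘(ℝ, ℝ) (𝓡 k) P 0 (1 : ℝ) : EuclideanSpace ℝ (Fin k)) = w := by
  set y := extChartAt (𝓡 k) p p with hy
  have hline : HasDerivAt (fun s : ℝ ↦ y + s • w) w 0 := by
    simpa using ((hasDerivAt_id (0 : ℝ)).smul_const w).const_add y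
  have h0 : y + (0 : ℝ) • w = y := by simp
  have hsymm : ContMDiffAt 𝓘(ℝ, EuclideanSpace ℝ (Fin k)) (𝓡 k) 2 (extChartAt (𝓡 k) p).symm y :=
    ((contMDiffOn_extChartAt_symm (I := 𝓡 k) p).contMDiffAt (extChartAt_target_mem_nhds p))
  have hd := (hsymm.mdifferentiableAt (by simp)).hasMFDerivAt
  -- The inverse chart has identity derivative at the base point, so the image of a straight line
  -- with direction `w` has initial velocity `w`.
  have hid : ∀ v : EuclideanSpace ℝ (Fin k),
      (mfderiv 𝓘(ℝ, EuclideanSpace ℝ (Fin k)) (𝓡 k) (extChartAt (𝓡 k) p).symm y v :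
        EuclideanSpace ℝ (Fin k)) = v := by
    intro v
    have h := mfderivWithin_range_extChartAt_symm (I := 𝓡 k) (x := p)
    rw [show Set.range (𝓡 k) = Set.univ by simp, mfderivWithin_univ] at h
    exact congr($h v)
  refine ⟨fun s ↦ (extChartAt (𝓡 k) p).symm (y + s • w), ?_, ?_, ?_⟩
  · simp [hy]
  · have hl : ContMDiffAt 𝓘(ℝ, ℝ) 𝓘(ℝ, EuclideanSpace ℝ (Fin k)) 2 (fun s : ℝ ↦ y + s • w) 0 :=
      ContDiffAt.contMDiffAt (by fun_prop)
    exact ContMDiffAt.comp (0 : ℝ) (by simpa using hsymm) hl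
  · have hd' : HasMFDerivAt 𝓘(ℝ, EuclideanSpace ℝ (Fin k)) (𝓡 k) (extChartAt (𝓡 k) p).symm
      (y + (0 : ℝ) • w) (mfderiv 𝓘(ℝ, EuclideanSpace ℝ (Fin k)) (𝓡 k)
        (extChartAt (𝓡 k) p).symm y) := by
      rw [h0]; exact hd
    have := (HasMFDerivAt.comp (0 : ℝ) hd' hline.hasFDerivAt.hasMFDerivAt).mfderiv
    refine Eq.trans congr($this (1 : ℝ)) ((hid _).trans (one_smul ℝ w))

theorem mul_mvfderiv_log {φ : N → ℝ} {p : N} (hφ : MDifferentiableAt (𝓡 k) 𝓘(ℝ, ℝ) φ p)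
    (h0 : φ p ≠ 0) (u : TangentSpace (𝓡 k) p) :
    φ p * mvfderiv (𝓡 k) (fun p' ↦ Real.log (φ p')) p u = mvfderiv (𝓡 k) φ p u := by
  have h := (HasMFDerivAt.comp p (Real.hasDerivAt_log h0).hasFDerivAt.hasMFDerivAt
    hφ.hasMFDerivAt).mfderiv
  have h' : mvfderiv (𝓡 k) (fun p' ↦ Real.log (φ p')) p u = mvfderiv (𝓡 k) φ p u * (φ p)⁻¹ :=
    congr($h u)
  rw [h']
  field_simp

theorem hasDerivAt_comp_curve {φ : N → ℝ} {P : ℝ → N} {s : ℝ}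
    (hφ : MDifferentiableAt (𝓡 k) 𝓘(ℝ, ℝ) φ (P s))
    (hP : MDifferentiableAt 𝓘(ℝ, ℝ) (𝓡 k) P s) :
    HasDerivAt (fun t ↦ φ (P t))
      (mvfderiv (𝓡 k) φ (P s) (mfderiv 𝓘(ℝ, ℝ) (𝓡 k) P s (1 : ℝ))) s := by
  have h : HasFDerivAt (fun t ↦ φ (P t))
      ((mvfderiv (𝓡 k) φ (P s)).comp (mfderiv 𝓘(ℝ, ℝ) (𝓡 k) P s) : ℝ →L[ℝ] ℝ) s :=
    hasMFDerivAt_iff_hasFDerivAt.1 (HasMFDerivAt.comp s hφ.hasMFDerivAt hP.hasMFDerivAt)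
  exact h.hasDerivAt

end Curves

/-! ### Metric coefficients of product variations -/

section BiWarped

variable {k₁ k₂ k₃ d : ℕ} {L₁ L₂ L₃ M : Type*}
  [TopologicalSpace L₁] [ChartedSpace (EuclideanSpace ℝ (Fin k₁)) L₁]
  [TopologicalSpace L₂] [ChartedSpace (EuclideanSpace ℝ (Fin k₂)) L₂]
  [TopologicalSpace L₃] [ChartedSpace (EuclideanSpace ℝ (Fin k₃)) L₃]
  [TopologicalSpace M] [ChartedSpace (EuclideanSpace ℝ (Fin d)) M]
  {f : L₁ × L₂ × L₃ → M}

/-- The velocity of `f ∘ (P, Q, R)` is the image under `df` of a vector whose components are the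
velocities of `P`, `Q` and `R`. -/
theorem exists_mfderiv_comp_eq {E : Type*} [NormedAddCommGroup E] [NormedSpace ℝ E]
    {H : Type*} [TopologicalSpace H] {I : ModelWithCorners ℝ E H}
    {A : Type*} [TopologicalSpace A] [ChartedSpace H A]
    {P : A → L₁} {Q : A → L₂} {R : A → L₃} {a : A}
    (hf : MDifferentiableAt ((𝓡 k₁).prod ((𝓡 k₂).prod (𝓡 k₃))) (𝓡 d) f (P a, Q a, R a))
    (hP : MDifferentiableAt I (𝓡 k₁) P a) (hQ : MDifferentiableAt I (𝓡 k₂) Q a)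
    (hR : MDifferentiableAt I (𝓡 k₃) R a) (v : TangentSpace I a) :
    ∃ V : TangentSpace ((𝓡 k₁).prod ((𝓡 k₂).prod (𝓡 k₃))) (P a, Q a, R a),
      mfderiv I (𝓡 d) (fun a ↦ f (P a, Q a, R a)) a v =
        mfderiv ((𝓡 k₁).prod ((𝓡 k₂).prod (𝓡 k₃))) (𝓡 d) f (P a, Q a, R a) V ∧
      mfderiv ((𝓡 k₁).prod ((𝓡 k₂).prod (𝓡 k₃))) (𝓡 k₁) (fun y : L₁ × L₂ × L₃ ↦ y.1)
        (P a, Q a, R a) V = mfderiv I (𝓡 k₁) P a v ∧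
      mfderiv ((𝓡 k₁).prod ((𝓡 k₂).prod (𝓡 k₃))) (𝓡 k₂) (fun y : L₁ × L₂ × L₃ ↦ y.2.1)
        (P a, Q a, R a) V = mfderiv I (𝓡 k₂) Q a v ∧
      mfderiv ((𝓡 k₁).prod ((𝓡 k₂).prod (𝓡 k₃))) (𝓡 k₃) (fun y : L₁ × L₂ × L₃ ↦ y.2.2)
        (P a, Q a, R a) V = mfderiv I (𝓡 k₃) R a v := by
  have hΓ : MDifferentiableAt I ((𝓡 k₁).prod ((𝓡 k₂).prod (𝓡 k₃)))
      (fun a ↦ (P a, Q a, R a)) a := hP.prodMk (hQ.prodMk hR)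
  refine ⟨mfderiv I ((𝓡 k₁).prod ((𝓡 k₂).prod (𝓡 k₃))) (fun a ↦ (P a, Q a, R a)) a v, ?_, ?_,
    ?_, ?_⟩
  · exact congr($(mfderiv_comp a hf hΓ) v)
  · exact congr($(mfderiv_comp a (g := fun y : L₁ × L₂ × L₃ ↦ y.1)
      mdifferentiableAt_fst hΓ) v).symm
  · exact congr($(mfderiv_comp a (g := fun y : L₁ × L₂ × L₃ ↦ y.2.1)
      (mdifferentiableAt_fst.comp _ mdifferentiableAt_snd) hΓ) v).symm
  · exact congr($(mfderiv_comp a (g := fun y : L₁ × L₂ × L₃ ↦ y.2.2)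
      (mdifferentiableAt_snd.comp _ mdifferentiableAt_snd) hΓ) v).symm

theorem exists_mfderiv_curves_eq
    (hf : MDifferentiable ((𝓡 k₁).prod ((𝓡 k₂).prod (𝓡 k₃))) (𝓡 d) f)
    {P : ℝ → L₁} {Q : ℝ → L₂} {R : ℝ → L₃} {z : ℝ × ℝ}
    (hP : MDifferentiableAt 𝓘(ℝ, ℝ) (𝓡 k₁) P z.1)
    (hQ : MDifferentiableAt 𝓘(ℝ, ℝ) (𝓡 k₂) Q z.2)
    (hR : MDifferentiableAt 𝓘(ℝ, ℝ) (𝓡 k₃) R z.2) (v : ℝ × ℝ) :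
    ∃ V : TangentSpace ((𝓡 k₁).prod ((𝓡 k₂).prod (𝓡 k₃))) (P z.1, Q z.2, R z.2),
      mfderiv 𝓘(ℝ, ℝ × ℝ) (𝓡 d) (fun z : ℝ × ℝ ↦ f (P z.1, Q z.2, R z.2)) z v =
        mfderiv ((𝓡 k₁).prod ((𝓡 k₂).prod (𝓡 k₃))) (𝓡 d) f (P z.1, Q z.2, R z.2) V ∧
      mfderiv ((𝓡 k₁).prod ((𝓡 k₂).prod (𝓡 k₃))) (𝓡 k₁) (fun y : L₁ × L₂ × L₃ ↦ y.1)
        (P z.1, Q z.2, R z.2) V = mfderiv 𝓘(ℝ, ℝ) (𝓡 k₁) P z.1 v.1 ∧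
      mfderiv ((𝓡 k₁).prod ((𝓡 k₂).prod (𝓡 k₃))) (𝓡 k₂) (fun y : L₁ × L₂ × L₃ ↦ y.2.1)
        (P z.1, Q z.2, R z.2) V = mfderiv 𝓘(ℝ, ℝ) (𝓡 k₂) Q z.2 v.2 ∧
      mfderiv ((𝓡 k₁).prod ((𝓡 k₂).prod (𝓡 k₃))) (𝓡 k₃) (fun y : L₁ × L₂ × L₃ ↦ y.2.2)
        (P z.1, Q z.2, R z.2) V = mfderiv 𝓘(ℝ, ℝ) (𝓡 k₃) R z.2 v.2 := by
  have d1 : HasMFDerivAt 𝓘(ℝ, ℝ × ℝ) 𝓘(ℝ, ℝ) (fun z : ℝ × ℝ ↦ z.1) z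
    (ContinuousLinearMap.fst ℝ ℝ ℝ) := hasFDerivAt_fst.hasMFDerivAt
  have d2 : HasMFDerivAt 𝓘(ℝ, ℝ × ℝ) 𝓘(ℝ, ℝ) (fun z : ℝ × ℝ ↦ z.2) z
    (ContinuousLinearMap.snd ℝ ℝ ℝ) := hasFDerivAt_snd.hasMFDerivAt
  have hP' := HasMFDerivAt.comp z hP.hasMFDerivAt d1
  have hQ' := HasMFDerivAt.comp z hQ.hasMFDerivAt d2
  have hR' := HasMFDerivAt.comp z hR.hasMFDerivAt d2
  obtain ⟨V, hV, hV1, hV2, hV3⟩ := exists_mfderiv_comp_eq (I := 𝓘(ℝ, ℝ × ℝ))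
    (hf (P z.1, Q z.2, R z.2)) hP'.mdifferentiableAt hQ'.mdifferentiableAt hR'.mdifferentiableAt v
  exact ⟨V, hV, hV1.trans congr($hP'.mfderiv v), hV2.trans congr($hQ'.mfderiv v),
    hV3.trans congr($hR'.mfderiv v)⟩

variable {φ₁ φ₂ : L₁ → ℝ}
  [RiemannianBundle (fun p : L₁ ↦ TangentSpace (𝓡 k₁) p)]
  [RiemannianBundle (fun q : L₂ ↦ TangentSpace (𝓡 k₂) q)]
  [RiemannianBundle (fun r : L₃ ↦ TangentSpace (𝓡 k₃) r)]
  [RiemannianBundle (fun x : M ↦ TangentSpace (𝓡 d) x)]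

/-- Metric coefficients of the variation `f (P s, Q t, R t)`. -/
theorem IsBiWarpedProductImmersion.inner_mfderiv_curves
    (hf : IsBiWarpedProductImmersion (k₁ := k₁) (k₂ := k₂) (k₃ := k₃) (d := d) f φ₁ φ₂)
    {P : ℝ → L₁} {Q : ℝ → L₂} {R : ℝ → L₃} {z : ℝ × ℝ}
    (hP : MDifferentiableAt 𝓘(ℝ, ℝ) (𝓡 k₁) P z.1)
    (hQ : MDifferentiableAt 𝓘(ℝ, ℝ) (𝓡 k₂) Q z.2)
    (hR : MDifferentiableAt 𝓘(ℝ, ℝ) (𝓡 k₃) R z.2) (v w : ℝ × ℝ) :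
    (inner ℝ (mfderiv 𝓘(ℝ, ℝ × ℝ) (𝓡 d) (fun z : ℝ × ℝ ↦ f (P z.1, Q z.2, R z.2)) z v)
      (mfderiv 𝓘(ℝ, ℝ × ℝ) (𝓡 d) (fun z : ℝ × ℝ ↦ f (P z.1, Q z.2, R z.2)) z w) : ℝ) =
      inner ℝ (mfderiv 𝓘(ℝ, ℝ) (𝓡 k₁) P z.1 v.1) (mfderiv 𝓘(ℝ, ℝ) (𝓡 k₁) P z.1 w.1)
      + φ₁ (P z.1) ^ 2 *
        inner ℝ (mfderiv 𝓘(ℝ, ℝ) (𝓡 k₂) Q z.2 v.2) (mfderiv 𝓘(ℝ, ℝ) (𝓡 k₂) Q z.2 w.2)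
      + φ₂ (P z.1) ^ 2 *
        inner ℝ (mfderiv 𝓘(ℝ, ℝ) (𝓡 k₃) R z.2 v.2) (mfderiv 𝓘(ℝ, ℝ) (𝓡 k₃) R z.2 w.2) := by
  have hfd := hf.contMDiff.mdifferentiable (by simp)
  obtain ⟨V, hV, hV1, hV2, hV3⟩ := exists_mfderiv_curves_eq hfd hP hQ hR v
  obtain ⟨W, hW, hW1, hW2, hW3⟩ := exists_mfderiv_curves_eq hfd hP hQ hR w
  rw [hV, hW, hf.inner_mfderiv, hV1, hV2, hV3, hW1, hW2, hW3]

/-- The leaves of the first factor are orthogonal to the variations in the other factors. -/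
theorem IsBiWarpedProductImmersion.inner_leaf_curves
    (hf : IsBiWarpedProductImmersion (k₁ := k₁) (k₂ := k₂) (k₃ := k₃) (d := d) f φ₁ φ₂)
    {P : ℝ → L₁} {Q : ℝ → L₂} {R : ℝ → L₃} {z : ℝ × ℝ}
    (hP : MDifferentiableAt 𝓘(ℝ, ℝ) (𝓡 k₁) P z.1)
    (hQ : MDifferentiableAt 𝓘(ℝ, ℝ) (𝓡 k₂) Q z.2)
    (hR : MDifferentiableAt 𝓘(ℝ, ℝ) (𝓡 k₃) R z.2) {X : TangentSpace (𝓡 d) (f (P z.1, Q z.2, R z.2))}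
    (hX : X ∈ immersedTangentSpace (k := k₁) (fun p ↦ f (p, Q z.2, R z.2)) (P z.1)) :
    (inner ℝ X (mfderiv 𝓘(ℝ, ℝ × ℝ) (𝓡 d) (fun z : ℝ × ℝ ↦ f (P z.1, Q z.2, R z.2)) z
      ((0, 1) : ℝ × ℝ)) : ℝ) = 0 := by
  obtain ⟨u, rfl⟩ := hX
  have hfd := hf.contMDiff.mdifferentiable (by simp)
  obtain ⟨V, hV, -, hV2, hV3⟩ := exists_mfderiv_comp_eq (I := 𝓡 k₁) (P := fun p : L₁ ↦ p)
    (Q := fun _ ↦ Q z.2) (R := fun _ ↦ R z.2) (a := P z.1) (hfd _)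
    mdifferentiableAt_id mdifferentiableAt_const mdifferentiableAt_const u
  obtain ⟨W, hW, hW1, -, -⟩ := exists_mfderiv_curves_eq hfd hP hQ hR (0, 1)
  have key := hf.inner_mfderiv _ V W
  have h0 : mfderiv 𝓘(ℝ, ℝ) (𝓡 k₁) P z.1 (0 : ℝ) = 0 := map_zero _
  rw [mfderiv_const] at hV2 hV3
  rw [← hV, ← hW, hV2, hV3, hW1] at key
  refine key.trans ?_
  simp only [h0, zero_apply, inner_zero_left, inner_zero_right, mul_zero, add_zero]

end BiWarped

/-- Put `Y = ξ` in the compatibility of `g` with `Φ`: the left side vanishes because `Φ ξ = 0`, and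
`η(ξ) = 1`. -/
theorem AlmostContactMetricStructure.η_eq_inner {d : ℕ} {M : Type*} [TopologicalSpace M]
    [ChartedSpace (EuclideanSpace ℝ (Fin d)) M] [IsManifold (𝓡 d) ∞ M]
    [RiemannianBundle (fun x : M ↦ TangentSpace (𝓡 d) x)]
    (S : AlmostContactMetricStructure d M) (x : M) (X : TangentSpace (𝓡 d) x) :
    S.η x X = inner ℝ (S.ξ x) X := by
  have h := S.inner_Φ_Φ x X (S.ξ x)
  rw [S.Φ_ξ, inner_zero_right, S.η_ξ, real_inner_comm] at h
  linarith

/-! ### Comparison of the two computations of `g(∇_v ξ, v)` -/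

section WarpingFunctions

variable {k₁ k₂ k₃ d : ℕ} {L₁ L₂ L₃ M : Type*}
  [TopologicalSpace L₁] [ChartedSpace (EuclideanSpace ℝ (Fin k₁)) L₁] [IsManifold (𝓡 k₁) ∞ L₁]
  [TopologicalSpace L₂] [ChartedSpace (EuclideanSpace ℝ (Fin k₂)) L₂] [IsManifold (𝓡 k₂) ∞ L₂]
  [TopologicalSpace L₃] [ChartedSpace (EuclideanSpace ℝ (Fin k₃)) L₃] [IsManifold (𝓡 k₃) ∞ L₃]
  [TopologicalSpace M] [ChartedSpace (EuclideanSpace ℝ (Fin d)) M] [IsManifold (𝓡 d) ∞ M]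
  [RiemannianBundle (fun p : L₁ ↦ TangentSpace (𝓡 k₁) p)]
  [RiemannianBundle (fun q : L₂ ↦ TangentSpace (𝓡 k₂) q)]
  [RiemannianBundle (fun r : L₃ ↦ TangentSpace (𝓡 k₃) r)]
  [RiemannianBundle (fun x : M ↦ TangentSpace (𝓡 d) x)]
  [IsContMDiffRiemannianBundle (𝓡 d) ∞ (EuclideanSpace ℝ (Fin d))
    (fun x : M ↦ TangentSpace (𝓡 d) x)]
  {f : L₁ × L₂ × L₃ → M} {φ₁ φ₂ : L₁ → ℝ}

/-- The identity `g(∇_v ξ, v) = β |v|²` for the velocity `v` of a curve `(Q, R)` in the last two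
factors, in terms of the warping functions. -/
theorem IsBiWarpedProductImmersion.mvfderiv_warping_eq
    (hf : IsBiWarpedProductImmersion (k₁ := k₁) (k₂ := k₂) (k₃ := k₃) (d := d) f φ₁ φ₂)
    {S : AlmostContactMetricStructure d M} {β : M → ℝ}
    (hM : IsLocallyConformalAlmostCosymplectic S β)
    (hξ : ∀ (q : L₂) (r : L₃), IsReebTangent (k := k₁) S (fun p : L₁ ↦ f (p, q, r)))
    {P : ℝ → L₁} {Q : ℝ → L₂} {R : ℝ → L₃}
    (hP : ContMDiffAt 𝓘(ℝ, ℝ) (𝓡 k₁) 2 P 0) (hQ : ContMDiffAt 𝓘(ℝ, ℝ) (𝓡 k₂) 2 Q 0)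
    (hR : ContMDiffAt 𝓘(ℝ, ℝ) (𝓡 k₃) 2 R 0)
    (hu : mfderiv (𝓡 k₁) (𝓡 d) (fun p ↦ f (p, Q 0, R 0)) (P 0)
      (mfderiv 𝓘(ℝ, ℝ) (𝓡 k₁) P 0 (1 : ℝ)) = S.ξ (f (P 0, Q 0, R 0))) :
    φ₁ (P 0) * mvfderiv (𝓡 k₁) φ₁ (P 0) (mfderiv 𝓘(ℝ, ℝ) (𝓡 k₁) P 0 (1 : ℝ)) *
        inner ℝ (mfderiv 𝓘(ℝ, ℝ) (𝓡 k₂) Q 0 (1 : ℝ)) (mfderiv 𝓘(ℝ, ℝ) (𝓡 k₂) Q 0 (1 : ℝ)) +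
      φ₂ (P 0) * mvfderiv (𝓡 k₁) φ₂ (P 0) (mfderiv 𝓘(ℝ, ℝ) (𝓡 k₁) P 0 (1 : ℝ)) *
        inner ℝ (mfderiv 𝓘(ℝ, ℝ) (𝓡 k₃) R 0 (1 : ℝ)) (mfderiv 𝓘(ℝ, ℝ) (𝓡 k₃) R 0 (1 : ℝ)) =
      β (f (P 0, Q 0, R 0)) *
        (φ₁ (P 0) ^ 2 *
          inner ℝ (mfderiv 𝓘(ℝ, ℝ) (𝓡 k₂) Q 0 (1 : ℝ)) (mfderiv 𝓘(ℝ, ℝ) (𝓡 k₂) Q 0 (1 : ℝ)) +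
        φ₂ (P 0) ^ 2 *
          inner ℝ (mfderiv 𝓘(ℝ, ℝ) (𝓡 k₃) R 0 (1 : ℝ)) (mfderiv 𝓘(ℝ, ℝ) (𝓡 k₃) R 0 (1 : ℝ))) := by
  obtain ⟨-, cov, hcov, -, hcovξ⟩ := hM
  set F : ℝ × ℝ → M := fun z ↦ f (P z.1, Q z.2, R z.2)
  have hPe : ∀ᶠ s in 𝓝 (0 : ℝ), MDifferentiableAt 𝓘(ℝ, ℝ) (𝓡 k₁) P s :=
    ((contMDiffAt_iff_contMDiffAt_nhds (by simp)).1 hP).mono fun _ h ↦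
      h.mdifferentiableAt (by simp)
  have hQe : ∀ᶠ s in 𝓝 (0 : ℝ), MDifferentiableAt 𝓘(ℝ, ℝ) (𝓡 k₂) Q s :=
    ((contMDiffAt_iff_contMDiffAt_nhds (by simp)).1 hQ).mono fun _ h ↦
      h.mdifferentiableAt (by simp)
  have hRe : ∀ᶠ s in 𝓝 (0 : ℝ), MDifferentiableAt 𝓘(ℝ, ℝ) (𝓡 k₃) R s :=
    ((contMDiffAt_iff_contMDiffAt_nhds (by simp)).1 hR).mono fun _ h ↦
      h.mdifferentiableAt (by simp)
  have hP0 := hPe.self_of_nhds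
  have hQ0 := hQe.self_of_nhds
  have hR0 := hRe.self_of_nhds
  have hfst : ContMDiffAt 𝓘(ℝ, ℝ × ℝ) 𝓘(ℝ, ℝ) 2 (fun z : ℝ × ℝ ↦ z.1) (0, 0) :=
    contDiffAt_fst.contMDiffAt
  have hsnd : ContMDiffAt 𝓘(ℝ, ℝ × ℝ) 𝓘(ℝ, ℝ) 2 (fun z : ℝ × ℝ ↦ z.2) (0, 0) :=
    contDiffAt_snd.contMDiffAt
  have hF : ContMDiffAt 𝓘(ℝ, ℝ × ℝ) (𝓡 d) 2 F (0, 0) := by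
    have h := (hP.comp ((0, 0) : ℝ × ℝ) hfst).prodMk
      ((hQ.comp ((0, 0) : ℝ × ℝ) hsnd).prodMk (hR.comp ((0, 0) : ℝ × ℝ) hsnd))
    exact ((hf.contMDiff.of_le ENat.LEInfty.out).contMDiffAt).comp _ h
  have hV := (S.contMDiff_ξ.contMDiffAt (x := F (0, 0))).mdifferentiableAt (by simp)
  -- The hypothesis on `P` identifies the `s`-velocity with `ξ` at the origin alone, which is all
  -- the first variation formula asks.
  have hFξ : mfderiv 𝓘(ℝ, ℝ × ℝ) (𝓡 d) F (0, 0) ((1, 0) : ℝ × ℝ) = S.ξ (F (0, 0)) := by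
    have hγ : HasMFDerivAt 𝓘(ℝ, ℝ) 𝓘(ℝ, ℝ × ℝ) (fun s : ℝ ↦ (s, (0 : ℝ))) 0
      (ContinuousLinearMap.inl ℝ ℝ ℝ) := (hasFDerivAt_prodMk_left 0 0).hasMFDerivAt
    have h1 := (HasMFDerivAt.comp (f := fun s : ℝ ↦ (s, (0 : ℝ))) (0 : ℝ)
      (hF.mdifferentiableAt (by simp)).hasMFDerivAt hγ).mfderiv
    have hleaf : MDifferentiableAt (𝓡 k₁) (𝓡 d) (fun p ↦ f (p, Q 0, R 0)) (P 0) :=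
      (hf.contMDiff.mdifferentiable (by simp) (P 0, Q 0, R 0)).comp (P 0)
        (mdifferentiableAt_id.prodMk mdifferentiableAt_const)
    have h2 := mfderiv_comp (0 : ℝ) hleaf hP0
    exact congr($h1 (1 : ℝ)).symm.trans (congr($h2 (1 : ℝ)).trans hu)
  have hP_zero : ∀ s, mfderiv 𝓘(ℝ, ℝ) (𝓡 k₁) P s (0 : ℝ) = 0 := fun _ ↦ map_zero _
  have hQ_zero : ∀ s, mfderiv 𝓘(ℝ, ℝ) (𝓡 k₂) Q s (0 : ℝ) = 0 := fun _ ↦ map_zero _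
  have hR_zero : ∀ s, mfderiv 𝓘(ℝ, ℝ) (𝓡 k₃) R s (0 : ℝ) = 0 := fun _ ↦ map_zero _
  have hF_orth : ∀ᶠ t : ℝ in 𝓝 0,
      inner ℝ (mfderiv 𝓘(ℝ, ℝ × ℝ) (𝓡 d) F (0, t) ((1, 0) : ℝ × ℝ))
        (mfderiv 𝓘(ℝ, ℝ × ℝ) (𝓡 d) F (0, t) ((0, 1) : ℝ × ℝ)) = (0 : ℝ) := by
    filter_upwards [hQe, hRe] with t hQt hRt
    rw [hf.inner_mfderiv_curves (z := (0, t)) hP0 hQt hRt]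
    simp only [hP_zero, hQ_zero, hR_zero, inner_zero_left, inner_zero_right, mul_zero, add_zero]
  -- Here tangency of `ξ` is needed on the leaf through every nearby `(Q t, R t)`, since the
  -- relation will be differentiated in `t`.
  have hξ_orth : ∀ᶠ t : ℝ in 𝓝 0,
      inner ℝ (S.ξ (F (0, t))) (mfderiv 𝓘(ℝ, ℝ × ℝ) (𝓡 d) F (0, t) ((0, 1) : ℝ × ℝ))
        = (0 : ℝ) := by
    filter_upwards [hQe, hRe] with t hQt hRt
    exact hf.inner_leaf_curves (z := (0, t)) hP0 hQt hRt (hξ (Q t) (R t) (P 0))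
  have hD := hcov.hasDerivAt_inner_variation hF hV hFξ hF_orth hξ_orth
  have hη : S.η (F (0, 0)) (mfderiv 𝓘(ℝ, ℝ × ℝ) (𝓡 d) F (0, 0) ((0, 1) : ℝ × ℝ)) = 0 :=
    (S.η_eq_inner _ _).trans hξ_orth.self_of_nhds
  rw [hcovξ, hη, zero_smul, sub_zero, real_inner_smul_left,
    hf.inner_mfderiv_curves (z := (0, 0)) hP0 hQ0 hR0] at hD
  have hd₁ := hasDerivAt_comp_curve (hf.contMDiff_φ₁.mdifferentiable (by simp) (P 0)) hP0
  have hd₂ := hasDerivAt_comp_curve (hf.contMDiff_φ₂.mdifferentiable (by simp) (P 0)) hP0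
  have hE := (((hd₁.pow 2).mul_const
    (inner ℝ (mfderiv 𝓘(ℝ, ℝ) (𝓡 k₂) Q 0 (1 : ℝ)) (mfderiv 𝓘(ℝ, ℝ) (𝓡 k₂) Q 0 (1 : ℝ)))).add
    ((hd₂.pow 2).mul_const
    (inner ℝ (mfderiv 𝓘(ℝ, ℝ) (𝓡 k₃) R 0 (1 : ℝ)) (mfderiv 𝓘(ℝ, ℝ) (𝓡 k₃) R 0 (1 : ℝ)))))
  -- The same squared speed is differentiated through the warping functions; the `P`-term is absent
  -- because `∂/∂t` has no `L_ν`-component.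
  have huniq := hD.unique (hE.congr_of_eventuallyEq (by
    filter_upwards [hPe] with s hPs
    rw [hf.inner_mfderiv_curves (z := (s, 0)) hPs hQ0 hR0]
    simp only [hP_zero, inner_zero_left, zero_add]
    rfl))
  simp only [hP_zero, inner_zero_left, zero_add, Nat.cast_ofNat, Nat.add_one_sub_one,
    pow_one] at huniq
  linear_combination -huniq / 2

end WarpingFunctions

/-- Positive dimension supplies a nonzero model vector, and definiteness of the metric makes its
squared norm nonzero. This is the factor cancelled in the final division. -/
theorem exists_curve_inner_ne_zero {n : ℕ} (hn : 0 < n) {N : Type*} [TopologicalSpace N]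
    [ChartedSpace (EuclideanSpace ℝ (Fin n)) N] [IsManifold (𝓡 n) ∞ N]
    [RiemannianBundle (fun q : N ↦ TangentSpace (𝓡 n) q)] (q : N) :
    ∃ Q : ℝ → N, Q 0 = q ∧ ContMDiffAt 𝓘(ℝ, ℝ) (𝓡 n) 2 Q 0 ∧
      (inner ℝ (mfderiv 𝓘(ℝ, ℝ) (𝓡 n) Q 0 (1 : ℝ)) (mfderiv 𝓘(ℝ, ℝ) (𝓡 n) Q 0 (1 : ℝ)) : ℝ)
        ≠ 0 := by
  obtain ⟨Q, hQ0, hQ, hQ1⟩ := exists_curve_mfderiv_eq q (EuclideanSpace.single ⟨0, hn⟩ (1 : ℝ))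
  refine ⟨Q, hQ0, hQ, fun h ↦ ?_⟩
  have h0 : (mfderiv 𝓘(ℝ, ℝ) (𝓡 n) Q 0 (1 : ℝ) : EuclideanSpace ℝ (Fin n)) = 0 :=
    inner_self_eq_zero.1 h
  have h1 : EuclideanSpace.single (⟨0, hn⟩ : Fin n) (1 : ℝ) = 0 := hQ1.symm.trans h0
  simp at h1

theorem theorem3p2 {m k n₁ n₂ : ℕ} (hn₁ : 0 < n₁) (hn₂ : 0 < n₂)
    -- the ambient Riemannian manifold, of dimension `2m + 1`
    {M : Type*} [TopologicalSpace M] [T2Space M] [SecondCountableTopology M]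
    [ChartedSpace (EuclideanSpace ℝ (Fin (2 * m + 1))) M] [IsManifold (𝓡 (2 * m + 1)) ∞ M]
    [RiemannianBundle (fun x : M ↦ TangentSpace (𝓡 (2 * m + 1)) x)]
    [IsContMDiffRiemannianBundle (𝓡 (2 * m + 1)) ∞ (EuclideanSpace ℝ (Fin (2 * m + 1)))
      (fun x : M ↦ TangentSpace (𝓡 (2 * m + 1)) x)]
    -- the Riemannian manifolds `L_ν`, `L_T`, `L_⊥`
    {Lν : Type*} [TopologicalSpace Lν] [ChartedSpace (EuclideanSpace ℝ (Fin k)) Lν]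
    [IsManifold (𝓡 k) ∞ Lν] [RiemannianBundle (fun p : Lν ↦ TangentSpace (𝓡 k) p)]
    [IsContMDiffRiemannianBundle (𝓡 k) ∞ (EuclideanSpace ℝ (Fin k))
      (fun p : Lν ↦ TangentSpace (𝓡 k) p)]
    {LT : Type*} [TopologicalSpace LT] [ChartedSpace (EuclideanSpace ℝ (Fin n₁)) LT]
    [IsManifold (𝓡 n₁) ∞ LT] [RiemannianBundle (fun q : LT ↦ TangentSpace (𝓡 n₁) q)]
    [IsContMDiffRiemannianBundle (𝓡 n₁) ∞ (EuclideanSpace ℝ (Fin n₁))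
      (fun q : LT ↦ TangentSpace (𝓡 n₁) q)]
    {Lperp : Type*} [TopologicalSpace Lperp] [ChartedSpace (EuclideanSpace ℝ (Fin n₂)) Lperp]
    [IsManifold (𝓡 n₂) ∞ Lperp] [RiemannianBundle (fun r : Lperp ↦ TangentSpace (𝓡 n₂) r)]
    [IsContMDiffRiemannianBundle (𝓡 n₂) ∞ (EuclideanSpace ℝ (Fin n₂))
      (fun r : Lperp ↦ TangentSpace (𝓡 n₂) r)]
    (S : AlmostContactMetricStructure (2 * m + 1) M) (β : M → ℝ)
    (hM : IsLocallyConformalAlmostCosymplectic S β)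
    (f : Lν × LT × Lperp → M) (φ₁ φ₂ : Lν → ℝ)
    (hf : IsBiWarpedProductImmersion (k₁ := k) (k₂ := n₁) (k₃ := n₂) (d := 2 * m + 1) f φ₁ φ₂)
    (ν : ℝ)
    (hslant : ∀ (q : LT) (r : Lperp),
      IsProperSlantSubmanifold (k := k) S (fun p : Lν ↦ f (p, q, r)) ν)
    (hinv : ∀ (p : Lν) (r : Lperp),
      IsInvariantSubmanifold (k := n₁) S (fun q : LT ↦ f (p, q, r)))
    (hanti : ∀ (p : Lν) (q : LT),
      IsAntiInvariantSubmanifold (k := n₂) S (fun r : Lperp ↦ f (p, q, r)))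
    (hξ : ∀ (q : LT) (r : Lperp), IsReebTangent (k := k) S (fun p : Lν ↦ f (p, q, r))) :
    -- `u` is the vector `ξ`, viewed as a tangent vector of `L_ν`
    ∀ (p : Lν) (q : LT) (r : Lperp) (u : TangentSpace (𝓡 k) p),
      mfderiv (𝓡 k) (𝓡 (2 * m + 1)) (fun p' : Lν ↦ f (p', q, r)) p u = S.ξ (f (p, q, r)) →
      mvfderiv (𝓡 k) (fun p' : Lν ↦ Real.log (φ₁ p')) p u = β (f (p, q, r)) ∧
      mvfderiv (𝓡 k) (fun p' : Lν ↦ Real.log (φ₂ p')) p u = β (f (p, q, r)) := by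
  intro p q r u hu
  obtain ⟨P, rfl, hP, hPu⟩ := exists_curve_mfderiv_eq p u
  obtain rfl : mfderiv 𝓘(ℝ, ℝ) (𝓡 k) P 0 (1 : ℝ) = u := hPu
  constructor
  · obtain ⟨Q, rfl, hQ, hQ1⟩ := exists_curve_inner_ne_zero hn₁ q
    -- Keeping the `L_⊥`-component constant makes `v` tangent to `L_T`, which isolates `φ₁`.
    have h := hf.mvfderiv_warping_eq hM hξ hP hQ (R := fun _ ↦ r) contMDiffAt_const hu
    have hφ := mul_mvfderiv_log (hf.contMDiff_φ₁.mdifferentiable (by simp) (P 0))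
      (hf.φ₁_pos (P 0)).ne' (mfderiv 𝓘(ℝ, ℝ) (𝓡 k) P 0 (1 : ℝ))
    have h0 : inner ℝ (mfderiv 𝓘(ℝ, ℝ) (𝓡 n₂) (fun _ : ℝ ↦ r) 0 (1 : ℝ))
        (mfderiv 𝓘(ℝ, ℝ) (𝓡 n₂) (fun _ : ℝ ↦ r) 0 (1 : ℝ)) = (0 : ℝ) := by
      rw [mfderiv_const]
      exact inner_zero_left _
    rw [h0, mul_zero, mul_zero, add_zero, add_zero] at h
    rw [← hφ] at h
    -- Writing `dφ₁ = φ₁ d(ln φ₁)` leaves the common factor `φ₁² |Q'|²` on both sides.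
    refine mul_left_cancel₀ (mul_ne_zero (pow_ne_zero 2 (hf.φ₁_pos (P 0)).ne') hQ1) ?_
    linear_combination h
  · obtain ⟨R, rfl, hR, hR1⟩ := exists_curve_inner_ne_zero hn₂ r
    -- Symmetrically, a constant `L_T`-component isolates `φ₂`.
    have h := hf.mvfderiv_warping_eq hM hξ hP (Q := fun _ ↦ q) contMDiffAt_const hR hu
    have hφ := mul_mvfderiv_log (hf.contMDiff_φ₂.mdifferentiable (by simp) (P 0))
      (hf.φ₂_pos (P 0)).ne' (mfderiv 𝓘(ℝ, ℝ) (𝓡 k) P 0 (1 : ℝ))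
    have h0 : inner ℝ (mfderiv 𝓘(ℝ, ℝ) (𝓡 n₁) (fun _ : ℝ ↦ q) 0 (1 : ℝ))
        (mfderiv 𝓘(ℝ, ℝ) (𝓡 n₁) (fun _ : ℝ ↦ q) 0 (1 : ℝ)) = (0 : ℝ) := by
      rw [mfderiv_const]
      exact inner_zero_left _
    rw [h0, mul_zero, mul_zero, zero_add, zero_add] at h
    rw [← hφ] at h
    refine mul_left_cancel₀ (mul_ne_zero (pow_ne_zero 2 (hf.φ₂_pos (P 0)).ne') hR1) ?_
    linear_combination h
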